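/- **Definitions.** A \emph{Borel–Bratteli diagram} $B=(V,E)$ consists of pairwise disjoint, at most countable vertex sets $V_0,V_1,\dots$ with $V_0=\{v_0\}$ a single point, pairwise disjoint, at most countable edge sets $E_1,E_2,\dots$, and source and range maps $s:E_n\to V_{n-1}$, $r:E_n\to V_n$ ($n\ge1$), such that $s^{-1}(v)\ne\emptyset$ for every $v\in V=\bigcup_{n\ge0}V_n$, and $r^{-1}(v)$ is finite and nonempty for every $v\in V\setminus V_0$. Its path space $Y_B$ is the set of sequences $(e_n)_{n\ge1}$ with $e_n\in E_n$ and $r(e_n)=s(e_{n+1})$ for all $n\ge 1$, with the topology induced from the product of the discrete spaces $E_n$ and the corresponding Borel $\sigma$-algebra. An \emph{ordered Borel–Bratteli diagram} $B=(V,E,\ge)$ is a Borel–Bratteli diagram with a partial order on each $E_n$ in which two edges are comparable if and only if they have the same range (so each $r^{-1}(v)$ is linearly ordered), and such that $Y_B$ contains no path $(e_n)$ for which $e_n$ is the maximal element of $r^{-1}(r(e_n))$ for all sufficiently large $n$, and no path for which $e_n$ is the minimal element of $r^{-1}(r(e_n))$ for all sufficiently large $n$. Its \emph{Vershik transformation}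 $\varphi:Y_B\to Y_B$ sends $y=(e_n)$ to $(f_1,\dots,f_{k-1},f_k,e_{k+1},e_{k+2},\dots)$, where $k$ is the least index such that $e_k$ is not maximal in $r^{-1}(r(e_k))$, $f_k$ is the immediate successor of $e_k$ in $r^{-1}(r(e_k))$, and $(f_1,\dots,f_{k-1})$ is the unique path from $v_0$ to $s(f_k)$ all of whose edges $f_j$ are minimal in $r^{-1}(r(f_j))$. **Theorem.** Let $X$ be a nonempty standard Borel space and let $T:X\to X$ be an aperiodic Borel automorphism, i.e. a Borel bijection with Borel inverse such that $T^n x\ne x$ for all $x\in X$ and $n\ge1$. Then there exists an ordered Borel–Bratteli diagram $B=(V,E,\ge)$ such that the Vershik transformation $\varphi$ is a Borel automorphism of $Y_B$ and $(X,T)$ is isomorphic to $(Y_B,\varphi)$: there is a Borel isomorphism $F:X\to Y_B$ with $F(Tx)=\varphi(F(x))$ for all $x\in X$. -/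

import Mathlib

/-- A Borel–Bratteli diagram. `V n` is the `n`-th set of vertices; `E n` is the set of edges
joining `V n` to `V (n + 1)` (so edges are indexed from `0`). -/
structure BorelBratteliDiagram where
  V : ℕ → Type
  E : ℕ → Type
  root : V 0
  eq_root : ∀ v : V 0, v = root
  countable_V : ∀ n, Countable (V n)
  countable_E : ∀ n, Countable (E n)
  /-- the source map -/
  s : ∀ {n}, E n → V n
  /-- the range map -/
  r : ∀ {n}, E n → V (n + 1)
  exists_s_eq : ∀ {n} (v : V n), ∃ e : E n, s e = v
  exists_r_eq : ∀ {n} (v : V (n + 1)), ∃ e : E n, r e = v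
  finite_r : ∀ {n} (v : V (n + 1)), {e : E n | r e = v}.Finite

/-- The space of infinite paths of a Borel–Bratteli diagram. -/
@[ext]
structure BorelBratteliDiagram.Path (B : BorelBratteliDiagram) where
  edge : ∀ n, B.E n
  r_eq_s : ∀ n, B.r (edge n) = B.s (edge (n + 1))

namespace BorelBratteliDiagram

/-- The topology generated by cylinder sets: the subspace topology of the product of the
discrete spaces `B.E n`. -/
instance (B : BorelBratteliDiagram) : TopologicalSpace B.Path :=
  TopologicalSpace.induced Path.edge (@Pi.topologicalSpace ℕ B.E fun _ => ⊥)

instance (B : BorelBratteliDiagram) : MeasurableSpace B.Path := borel B.Path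

instance (B : BorelBratteliDiagram) : BorelSpace B.Path := ⟨rfl⟩

end BorelBratteliDiagram

/-- An ordered Borel–Bratteli diagram. Two edges of the same level are comparable exactly when
they have the same range, so each finite set `r⁻¹(v)` is linearly ordered, and `IsMax e`
(`IsMin e`) says that `e` is the largest (smallest) element of `r⁻¹(r(e))`. No infinite path has
all but finitely many of its edges maximal, or all but finitely many of its edges minimal. -/
structure OrderedBorelBratteliDiagram extends BorelBratteliDiagram where
  edgeOrder : ∀ n, PartialOrder (E n)
  comparable_iff : ∀ {n} (e f : E n), (e ≤ f ∨ f ≤ e) ↔ r e = r f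
  not_cofinal_max : ¬ ∃ y : toBorelBratteliDiagram.Path, ∃ N, ∀ n ≥ N, IsMax (y.edge n)
  not_cofinal_min : ¬ ∃ y : toBorelBratteliDiagram.Path, ∃ N, ∀ n ≥ N, IsMin (y.edge n)

namespace OrderedBorelBratteliDiagram

instance (B : OrderedBorelBratteliDiagram) (n : ℕ) : PartialOrder (B.E n) := B.edgeOrder n

/-- `z` is obtained from `y` by one step of the Vershik transformation: if `k` is the first level
at which the edge of `y` is not maximal, then the edge of `z` at level `k` is the immediate
successor of that of `y`, the edges of `z` below `k` are minimal, and above `k` the paths agree. -/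
def IsVershikStep (B : OrderedBorelBratteliDiagram) (y z : B.Path) : Prop :=
  ∃ k, (∀ j < k, IsMax (y.edge j)) ∧ ¬ IsMax (y.edge k) ∧ y.edge k ⋖ z.edge k ∧
    (∀ j < k, IsMin (z.edge j)) ∧ ∀ j > k, z.edge j = y.edge j

theorem r_eq_of_le (B : OrderedBorelBratteliDiagram) {n : ℕ} {e f : B.E n} (h : e ≤ f) :
    B.r e = B.r f :=
  (B.comparable_iff e f).1 (Or.inl h)

theorem exists_isMin (B : OrderedBorelBratteliDiagram) {n : ℕ} (v : B.V (n + 1)) :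
    ∃ e : B.E n, B.r e = v ∧ IsMin e := by
  obtain ⟨e, he⟩ := (B.finite_r v).exists_minimal (B.exists_r_eq v)
  exact ⟨e, he.1, fun f hf => he.2 ((B.r_eq_of_le hf).trans he.1) hf⟩

theorem exists_covBy (B : OrderedBorelBratteliDiagram) {n : ℕ} {e : B.E n} (he : ¬ IsMax e) :
    ∃ f : B.E n, e ⋖ f := by
  obtain ⟨f₀, hf₀⟩ := not_isMax_iff.1 he
  have hfin : {f : B.E n | e < f}.Finite :=
    (B.finite_r (B.r e)).subset fun f hf => (B.r_eq_of_le (le_of_lt hf)).symm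
  obtain ⟨f, hf⟩ := hfin.exists_minimal ⟨f₀, hf₀⟩
  exact ⟨f, hf.1, fun g hg hgf => hgf.not_ge (hf.2 hg hgf.le)⟩

theorem exists_path (B : OrderedBorelBratteliDiagram) (k : ℕ) (y : ∀ n, B.E n)
    (hy : ∀ n ≥ k, B.r (y n) = B.s (y (n + 1))) :
    ∃ z : B.Path, (∀ j < k, IsMin (z.edge j)) ∧ ∀ j ≥ k, z.edge j = y j := by
  induction k generalizing y with
  | zero => exact ⟨⟨y, fun n => hy n n.zero_le⟩, by simp, fun _ _ => rfl⟩
  | succ k ih =>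
    obtain ⟨e, her, hem⟩ := B.exists_isMin (B.s (y (k + 1)))
    obtain ⟨z, hz₁, hz₂⟩ := ih (Function.update y k e) (by
      intro n hn
      rcases hn.eq_or_lt with rfl | hn
      · simpa using her
      · rw [Function.update_of_ne (by omega), Function.update_of_ne (by omega)]
        exact hy n hn)
    refine ⟨z, fun j hj => ?_, fun j hj => ?_⟩
    · rcases (Nat.lt_succ_iff.1 hj).eq_or_lt with rfl | hj
      · rw [hz₂ j le_rfl]
        simpa using hem
      · exact hz₁ j hj
    · rw [hz₂ j (by omega), Function.update_of_ne (by omega)]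

theorem existsUnique_isVershikStep (B : OrderedBorelBratteliDiagram) (y : B.Path) :
    ∃! z : B.Path, B.IsVershikStep y z := by
  classical
  have hex : ∃ k, ¬ IsMax (y.edge k) := by
    by_contra! h
    exact B.not_cofinal_max ⟨y, 0, fun n _ => h n⟩
  obtain ⟨k, hk, hmin⟩ : ∃ k, ¬ IsMax (y.edge k) ∧ ∀ j < k, IsMax (y.edge j) :=
    ⟨Nat.find hex, Nat.find_spec hex, fun j hj => not_not.1 (Nat.find_min hex hj)⟩
  obtain ⟨f, hf⟩ := B.exists_covBy hk
  obtain ⟨z, hz₁, hz₂⟩ := B.exists_path k (Function.update y.edge k f) (by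
    intro n hn
    rw [Function.update_of_ne (show n + 1 ≠ k by omega), ← y.r_eq_s n]
    rcases hn.eq_or_lt with rfl | hn
    · simpa using (B.r_eq_of_le hf.le).symm
    · rw [Function.update_of_ne (by omega)])
  have hzk : z.edge k = f := by simpa using hz₂ k le_rfl
  have hzj : ∀ j > k, z.edge j = y.edge j := fun j hj => by
    rw [hz₂ j hj.le, Function.update_of_ne hj.ne']
  refine ⟨z, ⟨k, hmin, hk, hzk ▸ hf, hz₁, hzj⟩, ?_⟩
  rintro w ⟨l, hl₁, hl₂, hl₃, hl₄, hl₅⟩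
  have hlk : l = k :=
    le_antisymm (not_lt.1 fun h => hk (hl₁ _ h)) (not_lt.1 fun h => hl₂ (hmin _ h))
  subst hlk
  have hwl : w.edge l = f := by
    rcases (B.comparable_iff (w.edge l) f).2
      ((B.r_eq_of_le hl₃.le).symm.trans (B.r_eq_of_le hf.le)) with h | h
    · exact h.eq_or_lt.resolve_right fun h => hf.2 hl₃.1 h
    · exact (h.eq_or_lt.resolve_right fun h => hl₃.2 hf.1 h).symm
  have hlow : ∀ i ≤ l, w.edge (l - i) = z.edge (l - i) := by
    intro i
    induction i with
    | zero => intro _; simp [hwl, hzk]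
    | succ i ih =>
      intro hi
      obtain ⟨j, hj⟩ : ∃ j, l - i = j + 1 := ⟨l - i - 1, by omega⟩
      have hj' : l - (i + 1) = j := by omega
      have h := ih (by omega)
      rw [hj] at h
      rw [hj']
      have hr : B.r (w.edge j) = B.r (z.edge j) := by rw [w.r_eq_s, z.r_eq_s, h]
      have hwm := hl₄ j (by omega)
      have hzm := hz₁ j (by omega)
      rcases (B.comparable_iff _ _).2 hr with h | h
      · exact le_antisymm h (hzm h)
      · exact le_antisymm (hwm h) h
  ext n
  rcases le_or_gt n l with h | h
  · have := hlow (l - n) (by omega)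
    rwa [Nat.sub_sub_self h] at this
  · rw [hl₅ n h, hzj n h]

/-- The Vershik transformation of the path space of an ordered Borel–Bratteli diagram. -/
noncomputable def vershik (B : OrderedBorelBratteliDiagram) (y : B.Path) : B.Path :=
  (B.existsUnique_isVershikStep y).choose

theorem vershik_spec (B : OrderedBorelBratteliDiagram) (y : B.Path) :
    B.IsVershikStep y (B.vershik y) :=
  (B.existsUnique_isVershikStep y).choose_spec.1

end OrderedBorelBratteliDiagram

/-!
An injective bounded Borel function `f` on `X` yields complete sections `A n` which decrease to the
empty set: the points where `f` is close, but not equal, to its lower limit along the forward or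
the backward orbit. Refine the topology of `X`, without changing the Borel sets, to a
zero-dimensional Polish one for which `T` is a homeomorphism and every `A n` is clopen, and embed
`X` as a closed subset of the Baire space. Cutting the Kakutani tower over each `A n` according to
the itinerary of its base points gives a refining sequence of countable clopen tower partitions:
towers become vertices, and the copies of the bases of one partition in the towers of the next
become edges, ordered from bottom to top. If the itineraries also record the coordinates of the
closed embedding, then every path is realized by exactly one point. One step of `T` climbs one
level, and this is the Vershik step because no orbit point lies in all the `A n`.
-/

open Set Filter Topology MeasureTheory Equiv

namespace BorelBratteliDiagram

variable {B : BorelBratteliDiagram} {X Y : Type*} [TopologicalSpace X] [TopologicalSpace Y]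

theorem continuous_comp_edge {n : ℕ} (g : B.E n → Y) :
    Continuous fun p : B.Path => g (p.edge n) :=
  letI : ∀ n, TopologicalSpace (B.E n) := fun _ => ⊥
  (continuous_bot (f := g)).comp ((continuous_apply n).comp continuous_induced_dom)

theorem continuous_path {f : X → B.Path} (hf : ∀ n, IsLocallyConstant fun x => (f x).edge n) :
    Continuous f :=
  letI : ∀ n, TopologicalSpace (B.E n) := fun _ => ⊥
  continuous_induced_rng.2 (continuous_pi fun n => (hf n).continuous)

end BorelBratteliDiagram

section HittingTime

variable {X : Type*}

/-- The first time `k ≥ 0` at which the orbit of `x` under `f` meets `A`, and `0` if it never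
does. -/
noncomputable def hittingTime (f : X → X) (A : Set X) (x : X) : ℕ := sInf {k | f^[k] x ∈ A}

/-- The time elapsed since the last visit of the orbit of `x` to `A`: the height of `x` in the
Kakutani tower over `A`. -/
noncomputable def height (T : Perm X) (A : Set X) (x : X) : ℕ := hittingTime T.symm A x

/-- The point of the backward orbit of `x` at which it last visited `A`: the point of the base of
the Kakutani tower over `A` below `x`. -/
noncomputable def lastVisit (T : Perm X) (A : Set X) (x : X) : X := T.symm^[height T A x] x

/-- The first time `k > 0` at which the orbit of `x` meets `A`, for an arbitrary point `x`. -/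
noncomputable def returnTime (T : Perm X) (A : Set X) (x : X) : ℕ := hittingTime T A (T x) + 1

/-- The point at which the orbit of `x` next visits `A`, strictly after time `0`. -/
noncomputable def nextVisit (T : Perm X) (A : Set X) (x : X) : X := T^[returnTime T A x] x

/-- Every forward orbit and every backward orbit of `T` meets `A`. -/
structure IsBirecurrent (T : Perm X) (A : Set X) : Prop where
  exists_iterate_mem : ∀ x, ∃ k, T^[k] x ∈ A
  exists_symm_iterate_mem : ∀ x, ∃ k, T.symm^[k] x ∈ A

variable {f : X → X} {T : Perm X} {A A' : Set X} {x z : X} {j k : ℕ}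

theorem hittingTime_le (h : f^[k] x ∈ A) : hittingTime f A x ≤ k := Nat.sInf_le h

theorem iterate_hittingTime_mem (h : ∃ k, f^[k] x ∈ A) : f^[hittingTime f A x] x ∈ A :=
  Nat.sInf_mem h

theorem hittingTime_of_notMem (hx : x ∉ A) (h : ∃ k, f^[k] x ∈ A) :
    hittingTime f A x = hittingTime f A (f x) + 1 := by
  have hpos : hittingTime f A x ≠ 0 := fun h₀ => hx <| by
    simpa only [h₀, Function.iterate_zero_apply] using iterate_hittingTime_mem h
  exact (Nat.sInf_add (p := fun k => f^[k] x ∈ A) (Nat.one_le_iff_ne_zero.2 hpos)).symm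

theorem iterate_lastVisit (T : Perm X) (A : Set X) (x : X) :
    T^[height T A x] (lastVisit T A x) = x :=
  T.rightInverse_symm.iterate _ x

theorem height_of_mem (hx : x ∈ A) : height T A x = 0 := Nat.le_zero.1 (hittingTime_le hx)

theorem lastVisit_of_mem (hx : x ∈ A) : lastVisit T A x = x := by
  rw [lastVisit, height_of_mem hx, Function.iterate_zero_apply]

theorem height_le_of_iterate_eq (hz : z ∈ A) (h : T^[k] z = x) : height T A x ≤ k :=
  hittingTime_le <| by rwa [← h, (T.leftInverse_symm.iterate k).eq]

theorem returnTime_pos (T : Perm X) (A : Set X) (x : X) : 0 < returnTime T A x := Nat.succ_pos _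

theorem returnTime_le (hk : k ≠ 0) (h : T^[k] x ∈ A) : returnTime T A x ≤ k := by
  obtain ⟨k, rfl⟩ := Nat.exists_eq_succ_of_ne_zero hk
  exact Nat.succ_le_succ (hittingTime_le h)

theorem nextVisit_of_apply_mem (h : T x ∈ A) : nextVisit T A x = T x := by
  rw [nextVisit, le_antisymm (returnTime_le one_ne_zero h) (returnTime_pos T A x),
    Function.iterate_one]

theorem iterate_height_sub_height (h : lastVisit T A z = lastVisit T A x)
    (hle : height T A z ≤ height T A x) : T^[height T A x - height T A z] z = x := by
  have hz : T^[height T A z] (lastVisit T A x) = z := h ▸ iterate_lastVisit T A z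
  obtain ⟨d, hd⟩ := Nat.exists_eq_add_of_le' hle
  rw [hd, Nat.add_sub_cancel, ← hz, ← Function.iterate_add_apply, ← hd, iterate_lastVisit]

theorem height_add_height_le (hz : z ∈ A) (h : lastVisit T A' z = lastVisit T A' x)
    (hle : height T A' z ≤ height T A' x) : height T A' z + height T A x ≤ height T A' x := by
  have := height_le_of_iterate_eq hz (iterate_height_sub_height h hle)
  omega

theorem height_add_returnTime_le (hz : z ∈ A) (h : lastVisit T A' z = lastVisit T A' x)
    (hlt : height T A' x < height T A' z) :
    height T A' x + returnTime T A x ≤ height T A' z := by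
  have := returnTime_le (Nat.sub_ne_zero_of_lt hlt)
    ((iterate_height_sub_height h.symm hlt.le).symm ▸ hz)
  omega

namespace IsBirecurrent

variable (hA : IsBirecurrent T A)
include hA

theorem lastVisit_mem (x : X) : lastVisit T A x ∈ A :=
  iterate_hittingTime_mem (hA.exists_symm_iterate_mem x)

theorem nextVisit_mem (x : X) : nextVisit T A x ∈ A :=
  iterate_hittingTime_mem (hA.exists_iterate_mem (T x))

theorem height_apply (hx : T x ∉ A) : height T A (T x) = height T A x + 1 := by
  rw [height, hittingTime_of_notMem hx (hA.exists_symm_iterate_mem _), T.symm_apply_apply, height]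

theorem lastVisit_apply (hx : T x ∉ A) : lastVisit T A (T x) = lastVisit T A x := by
  rw [lastVisit, hA.height_apply hx, Function.iterate_succ_apply, T.symm_apply_apply, lastVisit]

theorem height_and_lastVisit_iterate (hj : j < returnTime T A x) :
    height T A (T^[j] x) = height T A x + j ∧ lastVisit T A (T^[j] x) = lastVisit T A x := by
  induction j with
  | zero => exact ⟨rfl, rfl⟩
  | succ j ih =>
    obtain ⟨hh, hl⟩ := ih (by omega)
    have hmem : T (T^[j] x) ∉ A := fun h =>
      hj.not_ge (returnTime_le j.succ_ne_zero (by rwa [Function.iterate_succ_apply']))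
    rw [Function.iterate_succ_apply', hA.height_apply hmem, hA.lastVisit_apply hmem, hh, hl]
    exact ⟨rfl, rfl⟩

theorem height_lt_returnTime_lastVisit (x : X) :
    height T A x < returnTime T A (lastVisit T A x) := by
  by_contra! hle
  obtain ⟨d, hd⟩ := Nat.exists_eq_add_of_le' hle
  have hx : T^[d] (T^[returnTime T A (lastVisit T A x)] (lastVisit T A x)) = x := by
    rw [← Function.iterate_add_apply, ← hd, iterate_lastVisit]
  have hlt := height_le_of_iterate_eq (hA.nextVisit_mem _) hx
  have hpos := returnTime_pos T A (lastVisit T A x)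
  omega

theorem mem_of_height_eq_zero (h : height T A x = 0) : x ∈ A := by
  simpa only [lastVisit, h, Function.iterate_zero_apply] using hA.lastVisit_mem x

theorem returnTime_le_of_subset (h : A ⊆ A') (x : X) : returnTime T A' x ≤ returnTime T A x :=
  returnTime_le (returnTime_pos T A x).ne' (h (hA.nextVisit_mem x))

theorem height_and_lastVisit_of_subset (hA' : IsBirecurrent T A') (h : A' ⊆ A) (x : X) :
    height T A' x = height T A' (lastVisit T A x) + height T A x ∧
      lastVisit T A' x = lastVisit T A' (lastVisit T A x) := by
  have hx := hA'.height_and_lastVisit_iterate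
    ((hA.height_lt_returnTime_lastVisit x).trans_le (hA'.returnTime_le_of_subset h _))
  rwa [iterate_lastVisit] at hx

theorem lastVisit_eq_of_subset (hA' : IsBirecurrent T A') (h : A' ⊆ A)
    (hx : lastVisit T A x ∈ A') : lastVisit T A' x = lastVisit T A x := by
  rw [(hA.height_and_lastVisit_of_subset hA' h x).2, lastVisit_of_mem hx]

theorem nextVisit_eq_of_subset (h : A ⊆ A') (hx : nextVisit T A' x ∈ A) :
    nextVisit T A x = nextVisit T A' x := by
  rw [nextVisit, le_antisymm (returnTime_le (returnTime_pos T A' x).ne' hx)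
    (hA.returnTime_le_of_subset h x), ← nextVisit]

end IsBirecurrent

end HittingTime

section Towers

variable {X : Type*} {T : Perm X}

/-- The atom containing `x` of the partition into the levels of the Kakutani towers over the sets
`{y ∈ A | l y = v}`: the tower, given by its label, and the level in that tower. -/
noncomputable def towerAtom (T : Perm X) (A : Set X) (l : X → ℕ) (x : X) : ℕ × ℕ :=
  (l (lastVisit T A x), height T A x)

/-- A vanishing sequence of markers: complete sections decreasing to the empty set. -/
structure IsVanishingMarkers (T : Perm X) (A : ℕ → Set X) : Prop where
  zero : A 0 = univ
  antitone : Antitone A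
  isBirecurrent : ∀ n, IsBirecurrent T (A n)
  iInter_eq_empty : ⋂ n, A n = ∅

/-- A refining sequence of partitions into Kakutani towers over vanishing markers; the base of the
`n`-th partition is cut into the towers by `label n`. -/
structure TowerSystem (T : Perm X) where
  base : ℕ → Set X
  isVanishingMarkers : IsVanishingMarkers T base
  label : ℕ → X → ℕ
  label_zero : ∀ x, label 0 x = 0
  returnTime_eq : ∀ {n y z}, y ∈ base n → z ∈ base n → label n y = label n z →
    returnTime T (base n) y = returnTime T (base n) z
  refines : ∀ {n x y}, towerAtom T (base (n + 1)) (label (n + 1)) x =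
    towerAtom T (base (n + 1)) (label (n + 1)) y →
      towerAtom T (base n) (label n) x = towerAtom T (base n) (label n) y

namespace TowerSystem

variable (S : TowerSystem T) {n : ℕ} {x y z : X}

/-- The atom of the `n`-th partition of the tower system that contains `x`. -/
noncomputable def atom (n : ℕ) (x : X) : ℕ × ℕ := towerAtom T (S.base n) (S.label n) x

theorem isBirecurrent (n : ℕ) : IsBirecurrent T (S.base n) := S.isVanishingMarkers.isBirecurrent n

theorem base_succ_subset (n : ℕ) : S.base (n + 1) ⊆ S.base n :=
  S.isVanishingMarkers.antitone n.le_succ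

theorem exists_notMem_base (x : X) : ∃ n, x ∉ S.base n := by
  simpa only [mem_iInter, not_forall] using S.isVanishingMarkers.iInter_eq_empty.subset.mt
    (notMem_empty x)

theorem exists_forall_mem_base_and_notMem_base_succ (x : X) :
    ∃ k, (∀ j ≤ k, x ∈ S.base j) ∧ x ∉ S.base (k + 1) := by
  classical
  have h := S.exists_notMem_base x
  have h₀ : Nat.find h ≠ 0 := fun h₀ =>
    (Nat.find_eq_zero h).1 h₀ (S.isVanishingMarkers.zero ▸ mem_univ x)
  obtain ⟨k, hk⟩ := Nat.exists_eq_succ_of_ne_zero h₀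
  exact ⟨k, fun j hj => not_not.1 (Nat.find_min h (by omega)),
    by simpa only [hk] using Nat.find_spec h⟩

theorem exists_ge_notMem_base {w : ℕ → X} (hw : ∀ n, w n ∈ S.base n)
    (hsucc : ∀ n, w n ∈ S.base (n + 1) → w (n + 1) = w n) (N : ℕ) :
    ∃ n ≥ N, w n ∉ S.base (n + 1) := by
  by_contra! hmem
  have hconst (n : ℕ) (hn : N ≤ n) : w n = w N := by
    induction n, hn using Nat.le_induction with
    | base => rfl
    | succ n hn ih => rw [hsucc n (hmem n hn), ih]
  obtain ⟨m, hm⟩ := S.exists_notMem_base (w N)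
  rw [← hconst (max m N) (le_max_right m N)] at hm
  exact hm (S.isVanishingMarkers.antitone (le_max_left m N) (hw _))

variable {S}

theorem atom_of_mem (hy : y ∈ S.base n) : S.atom n y = (S.label n y, 0) := by
  rw [atom, towerAtom, lastVisit_of_mem hy, height_of_mem hy]

theorem atom_iterate (hy : y ∈ S.base n) {k : ℕ} (hk : k < returnTime T (S.base n) y) :
    S.atom n (T^[k] y) = (S.label n y, k) := by
  obtain ⟨hh, hl⟩ := (S.isBirecurrent n).height_and_lastVisit_iterate hk
  rw [atom, towerAtom, hh, hl, lastVisit_of_mem hy, height_of_mem hy, zero_add]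

theorem exists_iterate_atom_eq (hy : y ∈ S.base n)
    (h : S.label n y = S.label n (lastVisit T (S.base n) x)) :
    height T (S.base n) x < returnTime T (S.base n) y ∧
      S.atom n (T^[height T (S.base n) x] y) = S.atom n x := by
  have hlt := (S.isBirecurrent n).height_lt_returnTime_lastVisit x
  rw [← S.returnTime_eq hy ((S.isBirecurrent n).lastVisit_mem x) h] at hlt
  exact ⟨hlt, by rw [atom_iterate hy hlt, h]; rfl⟩

theorem atom_eq_of_le {m : ℕ} (hmn : m ≤ n) (h : S.atom n x = S.atom n y) :
    S.atom m x = S.atom m y :=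
  Nat.decreasingInduction (motive := fun m _ => S.atom m x = S.atom m y)
    (fun _ _ => S.refines) h hmn

variable (S)

/-- The vertices at level `n` are the towers of the `n`-th partition. -/
abbrev Vertex (n : ℕ) : Type := S.label n '' S.base n

/-- The edges joining levels `n` and `n + 1` are the copies of the bases of the towers of the
`n`-th partition inside those of the next one: the levels of a tower of the next partition that are
contained in `S.base n`. -/
@[ext]
structure Edge (n : ℕ) where
  tower : ℕ
  level : ℕ
  mem : (tower, level) ∈ S.atom (n + 1) '' S.base n

variable {S}

namespace Edge

/-- The tower of the `n`-th partition whose base contains the edge `e`, read off from a point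
of `e`. -/
noncomputable def source (e : S.Edge n) : S.Vertex n :=
  ⟨S.label n e.mem.choose, mem_image_of_mem _ e.mem.choose_spec.1⟩

/-- The tower of the partition of index `n + 1` that contains `e`. -/
def range (e : S.Edge n) : S.Vertex (n + 1) :=
  ⟨e.tower, by
    obtain ⟨y, -, hy⟩ := e.mem
    exact ⟨_, (S.isBirecurrent (n + 1)).lastVisit_mem y, congrArg Prod.fst hy⟩⟩

/-- Edges of the same tower are ordered by their levels in that tower. -/
instance : PartialOrder (S.Edge n) where
  le e f := e.tower = f.tower ∧ e.level ≤ f.level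
  le_refl _ := ⟨rfl, le_rfl⟩
  le_trans _ _ _ h h' := ⟨h.1.trans h'.1, h.2.trans h'.2⟩
  le_antisymm _ _ h h' := Edge.ext h.1 (h.2.antisymm h'.2)

instance : Countable (S.Edge n) :=
  Function.Injective.countable (f := fun e : S.Edge n => (e.tower, e.level)) fun _ _ h =>
    Edge.ext (congrArg Prod.fst h) (congrArg Prod.snd h)

theorem range_eq_range_iff {e f : S.Edge n} : e.range = f.range ↔ e.tower = f.tower :=
  Subtype.ext_iff

theorem lt_iff {e f : S.Edge n} : e < f ↔ e.range = f.range ∧ e.level < f.level := by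
  rw [range_eq_range_iff]
  exact ⟨fun h => ⟨h.1.1, not_le.1 fun h' => h.2 ⟨h.1.1.symm, h'⟩⟩,
    fun h => ⟨⟨h.1, h.2.le⟩, fun h' => h.2.not_ge h'.2⟩⟩

theorem comparable_iff (e f : S.Edge n) : (e ≤ f ∨ f ≤ e) ↔ e.range = f.range := by
  rw [range_eq_range_iff]
  exact ⟨fun h => h.elim And.left fun h => h.1.symm,
    fun h => (le_total e.level f.level).imp (⟨h, ·⟩) (⟨h.symm, ·⟩)⟩

end Edge

/-- The tower of the `n`-th partition that contains `x`. -/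
noncomputable def vertexOf (S : TowerSystem T) (n : ℕ) (x : X) : S.Vertex n :=
  ⟨S.label n (lastVisit T (S.base n) x), mem_image_of_mem _ ((S.isBirecurrent n).lastVisit_mem x)⟩

/-- The edge that contains the base point of `x` in the `n`-th partition. -/
noncomputable def edgeOf (S : TowerSystem T) (n : ℕ) (x : X) : S.Edge n where
  tower := S.label (n + 1) (lastVisit T (S.base (n + 1)) (lastVisit T (S.base n) x))
  level := height T (S.base (n + 1)) (lastVisit T (S.base n) x)
  mem := mem_image_of_mem _ ((S.isBirecurrent n).lastVisit_mem x)

theorem vertexOf_val_of_mem (hy : y ∈ S.base n) : (S.vertexOf n y).1 = S.label n y :=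
  congrArg (S.label n) (lastVisit_of_mem hy)

theorem vertexOf_eq_of_lastVisit_eq (h : lastVisit T (S.base n) x = lastVisit T (S.base n) y) :
    S.vertexOf n x = S.vertexOf n y :=
  Subtype.ext (congrArg (S.label n) h)

theorem edgeOf_eq_of_lastVisit_eq (h : lastVisit T (S.base n) x = lastVisit T (S.base n) y) :
    S.edgeOf n x = S.edgeOf n y := by
  simp only [edgeOf, h]

theorem height_succ (n : ℕ) (x : X) :
    height T (S.base (n + 1)) x = (S.edgeOf n x).level + height T (S.base n) x :=
  ((S.isBirecurrent n).height_and_lastVisit_of_subset (S.isBirecurrent (n + 1))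
    (S.base_succ_subset n) x).1

theorem range_edgeOf (n : ℕ) (x : X) : (S.edgeOf n x).range = S.vertexOf (n + 1) x :=
  Subtype.ext (congrArg (S.label (n + 1)) ((S.isBirecurrent n).height_and_lastVisit_of_subset
    (S.isBirecurrent (n + 1)) (S.base_succ_subset n) x).2.symm)

theorem atom_succ (n : ℕ) (x : X) :
    S.atom (n + 1) x = ((S.edgeOf n x).tower, (S.edgeOf n x).level + height T (S.base n) x) :=
  Prod.ext (congrArg Subtype.val (range_edgeOf n x)).symm (height_succ n x)

theorem edgeOf_level_of_mem (hy : y ∈ S.base n) :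
    (S.edgeOf n y).level = height T (S.base (n + 1)) y :=
  congrArg (height T (S.base (n + 1))) (lastVisit_of_mem hy)

theorem edgeOf_eq_iff (hy : y ∈ S.base n) {e : S.Edge n} :
    S.edgeOf n y = e ↔ S.atom (n + 1) y = (e.tower, e.level) := by
  rw [atom_succ, height_of_mem hy, add_zero, Edge.ext_iff, Prod.mk.injEq]

theorem exists_edgeOf_eq (e : S.Edge n) : ∃ y ∈ S.base n, S.edgeOf n y = e := by
  obtain ⟨y, hy, he⟩ := e.mem
  exact ⟨y, hy, (edgeOf_eq_iff hy).2 he⟩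

theorem source_edgeOf (n : ℕ) (x : X) : (S.edgeOf n x).source = S.vertexOf n x := by
  obtain ⟨hz, h⟩ := (S.edgeOf n x).mem.choose_spec
  have hn : S.atom n _ = S.atom n (lastVisit T (S.base n) x) := S.refines h
  rw [atom_of_mem hz, atom_of_mem ((S.isBirecurrent n).lastVisit_mem x)] at hn
  exact Subtype.ext (congrArg Prod.fst hn)

theorem exists_edgeOf_eq_of_range_eq {e : S.Edge n} (h : e.range = S.vertexOf (n + 1) x) :
    ∃ z ∈ S.base n, lastVisit T (S.base (n + 1)) z = lastVisit T (S.base (n + 1)) x ∧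
      S.edgeOf n z = e := by
  obtain ⟨w, hw, rfl⟩ := exists_edgeOf_eq e
  have hx := (S.isBirecurrent (n + 1)).lastVisit_mem x
  rw [range_edgeOf] at h
  obtain ⟨hlt, hz⟩ := exists_iterate_atom_eq (x := w) hx (congrArg Subtype.val h).symm
  have hl := ((S.isBirecurrent (n + 1)).height_and_lastVisit_iterate hlt).2
  rw [lastVisit_of_mem hx] at hl
  have hmem := (S.isBirecurrent n).mem_of_height_eq_zero
    ((congrArg Prod.snd (S.refines hz)).trans (height_of_mem hw))
  exact ⟨_, hmem, hl, (edgeOf_eq_iff hmem).2 (hz.trans ((edgeOf_eq_iff hw).1 rfl))⟩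

theorem exists_vertexOf_eq (v : S.Vertex n) : ∃ y ∈ S.base n, S.vertexOf n y = v := by
  obtain ⟨y, hy, hv⟩ := v.2
  exact ⟨y, hy, Subtype.ext ((vertexOf_val_of_mem hy).trans hv)⟩

theorem finite_setOf_range_eq (v : S.Vertex (n + 1)) : {e : S.Edge n | e.range = v}.Finite := by
  obtain ⟨x, -, rfl⟩ := exists_vertexOf_eq v
  refine (finite_Iio (returnTime T (S.base (n + 1)) (lastVisit T (S.base (n + 1)) x))).of_injOn
    (f := Edge.level) (fun e he => ?_) fun e he f hf h => ?_
  · obtain ⟨z, hz, hl, rfl⟩ := exists_edgeOf_eq_of_range_eq he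
    have hlt := (S.isBirecurrent (n + 1)).height_lt_returnTime_lastVisit z
    rw [hl] at hlt
    exact (edgeOf_level_of_mem hz).trans_lt hlt
  · exact Edge.ext (Edge.range_eq_range_iff.1 (he.trans hf.symm)) h

variable (S) in
/-- The Bratteli diagram of a tower system. -/
@[reducible]
noncomputable def diagram [Nonempty X] : BorelBratteliDiagram where
  V := S.Vertex
  E := S.Edge
  root := S.vertexOf 0 (Classical.arbitrary X)
  eq_root v := by
    obtain ⟨y, -, rfl⟩ := exists_vertexOf_eq v
    exact Subtype.ext ((S.label_zero _).trans (S.label_zero _).symm)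
  countable_V _ := inferInstance
  countable_E _ := inferInstance
  s := Edge.source
  r := Edge.range
  exists_s_eq v := by
    obtain ⟨y, -, rfl⟩ := exists_vertexOf_eq v
    exact ⟨_, source_edgeOf _ y⟩
  exists_r_eq v := by
    obtain ⟨y, -, rfl⟩ := exists_vertexOf_eq v
    exact ⟨_, range_edgeOf _ y⟩
  finite_r := finite_setOf_range_eq

theorem exists_edgeOf_eq_of_edgeOf_lt {e : S.Edge n} (h : S.edgeOf n x < e) :
    ∃ z ∈ S.base n, lastVisit T (S.base (n + 1)) z = lastVisit T (S.base (n + 1)) x ∧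
      height T (S.base (n + 1)) x + returnTime T (S.base n) x ≤ height T (S.base (n + 1)) z ∧
        S.edgeOf n z = e := by
  rw [Edge.lt_iff] at h
  obtain ⟨z, hz, hl, rfl⟩ :=
    exists_edgeOf_eq_of_range_eq (h.1.symm.trans (range_edgeOf n x))
  refine ⟨z, hz, hl, height_add_returnTime_le hz hl (not_le.1 fun hle => ?_), rfl⟩
  have hlt := h.2
  have hadd := height_add_height_le hz hl hle
  rw [edgeOf_level_of_mem hz] at hlt
  rw [height_succ n x] at hadd
  omega

theorem edgeOf_covBy_edgeOf_nextVisit (h : nextVisit T (S.base n) x ∉ S.base (n + 1)) :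
    S.edgeOf n x ⋖ S.edgeOf n (nextVisit T (S.base n) x) := by
  have hA := S.isBirecurrent (n + 1)
  have hr : returnTime T (S.base n) x < returnTime T (S.base (n + 1)) x :=
    (hA.returnTime_le_of_subset (S.base_succ_subset n) x).lt_of_ne fun hr =>
      h (by rw [nextVisit, hr]; exact hA.nextVisit_mem x)
  obtain ⟨hh, hl⟩ := hA.height_and_lastVisit_iterate hr
  have hr_pos := returnTime_pos T (S.base n) x
  have hw : (S.edgeOf n (nextVisit T (S.base n) x)).level =
      height T (S.base (n + 1)) x + returnTime T (S.base n) x :=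
    (edgeOf_level_of_mem ((S.isBirecurrent n).nextVisit_mem x)).trans hh
  refine ⟨Edge.lt_iff.2 ⟨?_, ?_⟩, fun e he hew => ?_⟩
  · rw [range_edgeOf, range_edgeOf, vertexOf_eq_of_lastVisit_eq hl.symm]
    rfl
  · rw [hw, height_succ]
    omega
  · obtain ⟨z, hz, -, hle, rfl⟩ := exists_edgeOf_eq_of_edgeOf_lt he
    have hlt := (Edge.lt_iff.1 hew).2
    rw [hw, edgeOf_level_of_mem hz] at hlt
    exact hlt.not_ge hle

theorem isMax_edgeOf (h : nextVisit T (S.base n) x ∈ S.base (n + 1)) : IsMax (S.edgeOf n x) := by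
  refine isMax_iff_forall_not_lt.2 fun e he => ?_
  obtain ⟨z, -, hl, hle, -⟩ := exists_edgeOf_eq_of_edgeOf_lt he
  have hlt := (S.isBirecurrent (n + 1)).height_lt_returnTime_lastVisit z
  have hmem : T^[returnTime T (S.base n) x + height T (S.base (n + 1)) x]
      (lastVisit T (S.base (n + 1)) x) ∈ S.base (n + 1) := by
    rwa [Function.iterate_add_apply, iterate_lastVisit]
  rw [hl] at hlt
  have hr_pos := returnTime_pos T (S.base n) x
  have := returnTime_le (by omega) hmem
  omega

theorem isMax_edgeOf_iff :
    IsMax (S.edgeOf n x) ↔ nextVisit T (S.base n) x ∈ S.base (n + 1) :=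
  ⟨fun h => by_contra fun h' => h.not_lt (edgeOf_covBy_edgeOf_nextVisit h').lt, isMax_edgeOf⟩

theorem isMin_edgeOf_iff :
    IsMin (S.edgeOf n x) ↔ lastVisit T (S.base n) x ∈ S.base (n + 1) := by
  have hA := S.isBirecurrent (n + 1)
  refine ⟨fun h => hA.mem_of_height_eq_zero ?_, fun h e he => ⟨he.1.symm, ?_⟩⟩
  · have hy := hA.lastVisit_mem x
    have hy₀ := (edgeOf_level_of_mem (S.base_succ_subset n hy)).trans (height_of_mem hy)
    have hrange : (S.edgeOf n (lastVisit T (S.base (n + 1)) x)).range = (S.edgeOf n x).range := by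
      rw [range_edgeOf, range_edgeOf, vertexOf_eq_of_lastVisit_eq (lastVisit_of_mem hy)]
    exact Nat.le_zero.1 ((h ⟨Edge.range_eq_range_iff.1 hrange, hy₀.trans_le (Nat.zero_le _)⟩).2
      |>.trans_eq hy₀)
  · exact (height_of_mem h).trans_le (Nat.zero_le _)

theorem exists_ge_not_isMax_edgeOf (S : TowerSystem T) (x : X) (N : ℕ) :
    ∃ n ≥ N, ¬IsMax (S.edgeOf n x) := by
  simp only [isMax_edgeOf_iff]
  exact S.exists_ge_notMem_base (fun n => (S.isBirecurrent n).nextVisit_mem x)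
    (fun n => (S.isBirecurrent (n + 1)).nextVisit_eq_of_subset (S.base_succ_subset n)) N

theorem exists_ge_not_isMin_edgeOf (S : TowerSystem T) (x : X) (N : ℕ) :
    ∃ n ≥ N, ¬IsMin (S.edgeOf n x) := by
  simp only [isMin_edgeOf_iff]
  exact S.exists_ge_notMem_base (fun n => (S.isBirecurrent n).lastVisit_mem x)
    (fun n => (S.isBirecurrent n).lastVisit_eq_of_subset (S.isBirecurrent (n + 1))
      (S.base_succ_subset n)) N

section

variable [Nonempty X]

variable (S) in
/-- The path of the edges that contain the successive base points of `x`. -/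
noncomputable def pathOf (x : X) : S.diagram.Path where
  edge n := S.edgeOf n x
  r_eq_s n := (range_edgeOf n x).trans (source_edgeOf (n + 1) x).symm

/-- The atoms met by a path: the edges of the path give the tower, and the positions of these
edges add up to the level in the tower. -/
noncomputable def pathAtom (p : S.diagram.Path) (n : ℕ) : ℕ × ℕ :=
  ((p.edge n).source.1, ∑ m ∈ Finset.range n, (p.edge m).level)

theorem pathAtom_succ (p : S.diagram.Path) (n : ℕ) :
    pathAtom p (n + 1) = ((p.edge n).tower, (pathAtom p n).2 + (p.edge n).level) :=
  Prod.ext (congrArg Subtype.val (p.r_eq_s n)).symm (Finset.sum_range_succ _ _)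

theorem pathAtom_pathOf (x : X) : pathAtom (S.pathOf x) = fun n => S.atom n x := by
  funext n
  induction n with
  | zero =>
    refine Prod.ext (congrArg Subtype.val (source_edgeOf 0 x)) ?_
    exact (height_of_mem (S.isVanishingMarkers.zero ▸ mem_univ x)).symm
  | succ n ih => rw [pathAtom_succ, ih, atom_succ, add_comm]; rfl

theorem pathAtom_injective : Function.Injective (pathAtom : S.diagram.Path → ℕ → ℕ × ℕ) := by
  refine fun p q h => BorelBratteliDiagram.Path.ext (funext fun n => ?_)
  have hn := congrFun h (n + 1)
  rw [pathAtom_succ, pathAtom_succ, congrFun h n, Prod.mk.injEq, Nat.add_left_cancel_iff] at hn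
  exact Edge.ext hn.1 hn.2

theorem continuous_pathAtom : Continuous (pathAtom : S.diagram.Path → ℕ → ℕ × ℕ) := by
  have hsource (n : ℕ) : Continuous fun p : S.diagram.Path => (p.edge n).source.1 :=
    BorelBratteliDiagram.continuous_comp_edge (B := S.diagram) fun e => Edge.source e |>.1
  have hlevel (n : ℕ) : Continuous fun p : S.diagram.Path => (p.edge n).level :=
    BorelBratteliDiagram.continuous_comp_edge (B := S.diagram) Edge.level
  exact continuous_pi fun n =>
    (hsource n).prodMk (continuous_finsetSum (Finset.range n) fun m _ => hlevel m)

theorem exists_atom_eq_pathAtom (p : S.diagram.Path) (n : ℕ) :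
    ∃ x, ∀ m ≤ n, S.atom m x = pathAtom p m := by
  induction n with
  | zero =>
    obtain ⟨z, hz, hp⟩ := exists_edgeOf_eq (p.edge 0)
    refine ⟨z, fun m hm => ?_⟩
    rw [Nat.le_zero.1 hm, atom_of_mem hz, pathAtom, ← hp, source_edgeOf, Finset.sum_range_zero,
      vertexOf_val_of_mem hz]
  | succ n ih =>
    obtain ⟨x, hx⟩ := ih
    obtain ⟨z, hz, hp⟩ := exists_edgeOf_eq (p.edge n)
    have hlabel : S.label n z = S.label n (lastVisit T (S.base n) x) := by
      have := congrArg Prod.fst (hx n le_rfl)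
      rw [pathAtom, ← hp, source_edgeOf, vertexOf_val_of_mem hz] at this
      exact this.symm
    obtain ⟨hlt, hatom⟩ := exists_iterate_atom_eq hz hlabel
    refine ⟨T^[height T (S.base n) x] z, fun m hm => ?_⟩
    rcases Nat.le_succ_iff.1 hm with hm | rfl
    · rw [atom_eq_of_le hm hatom, hx m hm]
    · have hheight : height T (S.base n) (T^[height T (S.base n) x] z) = (pathAtom p n).2 :=
        congrArg Prod.snd (hatom.trans (hx n le_rfl))
      have hlast := ((S.isBirecurrent n).height_and_lastVisit_iterate hlt).2
      have hedge : S.edgeOf n (T^[height T (S.base n) x] z) = p.edge n :=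
        (edgeOf_eq_of_lastVisit_eq hlast).trans hp
      rw [pathAtom_succ, atom_succ, hheight, hedge, add_comm]

end

variable [TopologicalSpace X]

/-- The atoms are clopen, they determine their points, and every sequence of atoms with the finite
intersection property has a common point. -/
def IsComplete (S : TowerSystem T) : Prop :=
  IsClosedEmbedding fun x n => S.atom n x

theorem IsComplete.isLocallyConstant_edgeOf (hS : S.IsComplete) (n : ℕ) :
    IsLocallyConstant (S.edgeOf n) := by
  have hatom (m : ℕ) : IsLocallyConstant (S.atom m) :=
    (IsLocallyConstant.iff_continuous _).2 ((continuous_apply m).comp hS.continuous)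
  have hval (x : X) : ((S.edgeOf n x).tower, (S.edgeOf n x).level) =
      ((S.atom (n + 1) x).1, (S.atom (n + 1) x).2 - (S.atom n x).2) := by
    rw [atom_succ]
    exact Prod.ext rfl (Nat.add_sub_cancel ..).symm
  refine IsLocallyConstant.desc _ (fun e : S.Edge n => (e.tower, e.level)) ?_ fun e f h =>
    Edge.ext (congrArg Prod.fst h) (congrArg Prod.snd h)
  simpa only [Function.comp_def, Pi.sub_apply, hval] using ((hatom (n + 1)).comp Prod.fst).prodMk
    (((hatom (n + 1)).comp Prod.snd).sub ((hatom n).comp Prod.snd))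

variable [Nonempty X]

theorem IsComplete.isEmbedding_pathOf (hS : S.IsComplete) : IsEmbedding S.pathOf :=
  .of_comp (BorelBratteliDiagram.continuous_path hS.isLocallyConstant_edgeOf) continuous_pathAtom
    (by simpa only [Function.comp_def, pathAtom_pathOf] using hS.isEmbedding)

theorem IsComplete.surjective_pathOf (hS : S.IsComplete) : Function.Surjective S.pathOf := by
  intro p
  choose u hu using exists_atom_eq_pathAtom p
  have hlim : Tendsto (fun n m => S.atom m (u n)) atTop (𝓝 (pathAtom p)) :=
    tendsto_pi_nhds.2 fun m => tendsto_atTop_of_eventually_const fun n hn => hu n m hn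
  obtain ⟨x, hx⟩ := hS.isClosed_range.mem_of_tendsto hlim
    (Eventually.of_forall fun n => mem_range_self (u n))
  exact ⟨x, pathAtom_injective ((pathAtom_pathOf x).trans hx)⟩

/-- The Bratteli diagram of a complete tower system, with the edges of the same range ordered by
their levels. -/
@[reducible]
noncomputable def orderedDiagram (hS : S.IsComplete) : OrderedBorelBratteliDiagram where
  toBorelBratteliDiagram := S.diagram
  edgeOrder _ := inferInstanceAs (PartialOrder (S.Edge _))
  comparable_iff := Edge.comparable_iff
  not_cofinal_max := by
    rintro ⟨p, N, hN⟩
    obtain ⟨x, rfl⟩ := hS.surjective_pathOf p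
    obtain ⟨n, hn, hmax⟩ := S.exists_ge_not_isMax_edgeOf x N
    exact hmax (hN n hn)
  not_cofinal_min := by
    rintro ⟨p, N, hN⟩
    obtain ⟨x, rfl⟩ := hS.surjective_pathOf p
    obtain ⟨n, hn, hmin⟩ := S.exists_ge_not_isMin_edgeOf x N
    exact hmin (hN n hn)

theorem isVershikStep_pathOf (hS : S.IsComplete) (x : X) :
    (orderedDiagram hS).IsVershikStep (S.pathOf x) (S.pathOf (T x)) := by
  obtain ⟨k, hk, hk'⟩ := S.exists_forall_mem_base_and_notMem_base_succ (T x)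
  have hnext : nextVisit T (S.base k) x = T x := nextVisit_of_apply_mem (hk k le_rfl)
  have hcov : S.edgeOf k x ⋖ S.edgeOf k (T x) :=
    hnext ▸ edgeOf_covBy_edgeOf_nextVisit (hnext.symm ▸ hk')
  refine ⟨k, fun j hj => isMax_edgeOf ?_, hcov.lt.not_isMax, hcov,
    fun j hj => isMin_edgeOf_iff.2 ?_, fun j hj =>
      edgeOf_eq_of_lastVisit_eq ((S.isBirecurrent j).lastVisit_apply fun h => ?_)⟩
  · rw [nextVisit_of_apply_mem (hk j hj.le)]
    exact hk (j + 1) hj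
  · rw [lastVisit_of_mem (hk j hj.le)]
    exact hk (j + 1) hj
  · exact hk' (S.isVanishingMarkers.antitone hj h)

theorem exists_vershik_conjugacy [MeasurableSpace X] [BorelSpace X] {T : X ≃ᵐ X}
    {S : TowerSystem T.toEquiv} (hS : S.IsComplete) :
    ∃ (B : OrderedBorelBratteliDiagram) (φ : B.Path ≃ᵐ B.Path),
      (∀ y, φ y = B.vershik y) ∧ ∃ F : X ≃ᵐ B.Path, ∀ x, F (T x) = φ (F x) := by
  let F : X ≃ᵐ S.diagram.Path :=
    (hS.isEmbedding_pathOf.toHomeomorphOfSurjective hS.surjective_pathOf).toMeasurableEquiv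
  refine ⟨orderedDiagram hS, F.symm.trans (T.trans F), fun y => ?_, F, fun x => ?_⟩
  · obtain ⟨x, rfl⟩ := F.surjective y
    simp only [MeasurableEquiv.trans_apply, F.symm_apply_apply]
    exact ((orderedDiagram hS).existsUnique_isVershikStep (S.pathOf x)).unique
      (isVershikStep_pathOf hS x) ((orderedDiagram hS).vershik_spec _)
  · simp only [MeasurableEquiv.trans_apply, F.symm_apply_apply]

end TowerSystem

end Towers

section LocallyConstant

variable {X Y ι : Type*} [TopologicalSpace X]

theorem isLocallyConstant_eval {i : X → ι} {h : ι → X → Y} (hi : IsLocallyConstant i)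
    (hh : ∀ j, IsLocallyConstant (h j)) : IsLocallyConstant fun x => h (i x) x :=
  (IsLocallyConstant.iff_eventually_eq _).2 fun x => by
    filter_upwards [hi.eventually_eq x, (hh (i x)).eventually_eq x] with y hiy hy
    rw [hiy, hy]

theorem isLocallyConstant_sInf {U : ℕ → Set X} (hU : ∀ k, IsClopen (U k))
    (hcover : ∀ x, ∃ k, x ∈ U k) : IsLocallyConstant fun x => sInf {k | x ∈ U k} := by
  refine (IsLocallyConstant.iff_eventually_eq _).2 fun x => ?_
  have hmem : ∀ᶠ y in 𝓝 x, y ∈ U (sInf {k | x ∈ U k}) :=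
    (hU _).isOpen.mem_nhds (Nat.sInf_mem (hcover x))
  have hnotMem : ∀ᶠ y in 𝓝 x, ∀ j < sInf {k | x ∈ U k}, y ∉ U j :=
    (finite_Iio _).eventually_all.2 fun j hj =>
      (hU j).compl.isOpen.mem_nhds (Nat.notMem_of_lt_sInf hj)
  filter_upwards [hmem, hnotMem] with y hy hlt
  exact le_antisymm (Nat.sInf_le hy)
    (not_lt.1 fun h => hlt _ h (Nat.sInf_mem (s := {k | y ∈ U k}) ⟨_, hy⟩))

theorem isLocallyConstant_hittingTime {f : X → X} {A : Set X} (hf : Continuous f)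
    (hA : IsClopen A) (h : ∀ x, ∃ k, f^[k] x ∈ A) : IsLocallyConstant (hittingTime f A) :=
  isLocallyConstant_sInf (fun k => hA.preimage (hf.iterate k)) h

end LocallyConstant

section Itinerary

variable {X Y : Type*} {T : Perm X} {A : Set X} {c : X → Y} {y z : X}

/-- The values of `c` along the orbit of `y`, up to the next visit to `A`. -/
noncomputable def itinerary (T : Perm X) (A : Set X) (c : X → Y) (y : X) : List Y :=
  (List.range (returnTime T A y)).map fun i => c (T^[i] y)

theorem returnTime_eq_of_itinerary_eq (h : itinerary T A c y = itinerary T A c z) :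
    returnTime T A y = returnTime T A z := by
  simpa only [itinerary, List.length_map, List.length_range] using congrArg List.length h

theorem apply_iterate_eq_of_itinerary_eq (h : itinerary T A c y = itinerary T A c z) {i : ℕ}
    (hi : i < returnTime T A y) : c (T^[i] y) = c (T^[i] z) := by
  have hmap := h
  rw [itinerary, itinerary, ← returnTime_eq_of_itinerary_eq h] at hmap
  exact List.map_inj_left.1 hmap i (List.mem_range.2 hi)

theorem isLocallyConstant_itinerary [TopologicalSpace X] (hT : Continuous T)
    (hA : IsBirecurrent T A) (hclopen : IsClopen A) (hc : IsLocallyConstant c) :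
    IsLocallyConstant (itinerary T A c) := by
  have hreturn : IsLocallyConstant (returnTime T A) :=
    ((isLocallyConstant_hittingTime hT hclopen hA.exists_iterate_mem).comp_continuous hT).comp
      (· + 1)
  refine isLocallyConstant_eval (h := fun k y => (List.range k).map fun i => c (T^[i] y)) hreturn
    fun k => (IsLocallyConstant.iff_eventually_eq _).2 fun x => ?_
  have hprefix : ∀ᶠ y in 𝓝 x, ∀ i < k, c (T^[i] y) = c (T^[i] x) :=
    (finite_Iio k).eventually_all.2 fun i _ =>
      (hc.comp_continuous (hT.iterate i)).eventually_eq x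
  filter_upwards [hprefix] with y hy
  exact List.map_congr_left fun i hi => hy i (List.mem_range.1 hi)

theorem isLocallyConstant_towerAtom [TopologicalSpace X] (hT : Continuous T.symm)
    (hA : IsBirecurrent T A) (hclopen : IsClopen A) {l : X → ℕ} (hl : IsLocallyConstant l) :
    IsLocallyConstant (towerAtom T A l) := by
  have hheight : IsLocallyConstant (height T A) :=
    isLocallyConstant_hittingTime hT hclopen hA.exists_symm_iterate_mem
  exact (isLocallyConstant_eval (h := fun k x => l (T.symm^[k] x)) hheight fun k =>
    hl.comp_continuous (hT.iterate k)).prodMk hheight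

end Itinerary

namespace TowerSystem

variable {X : Type*} {T : Perm X} {A : ℕ → Set X}

/-- Labels that record the itinerary of a point through the atoms of the previous partition,
together with one coordinate of the code `g`. -/
noncomputable def itineraryLabel (T : Perm X) (A : ℕ → Set X) (g : X → ℕ → ℕ) : ℕ → X → ℕ
  | 0, _ => 0
  | n + 1, y => Encodable.encode (itinerary T (A (n + 1))
      (fun x => (g x n, towerAtom T (A n) (itineraryLabel T A g n) x)) y)

theorem itinerary_eq_of_itineraryLabel_eq {g : X → ℕ → ℕ} {n : ℕ} {y z : X}
    (h : itineraryLabel T A g (n + 1) y = itineraryLabel T A g (n + 1) z) :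
    itinerary T (A (n + 1)) (fun x => (g x n, towerAtom T (A n) (itineraryLabel T A g n) x)) y =
      itinerary T (A (n + 1)) (fun x => (g x n, towerAtom T (A n) (itineraryLabel T A g n) x)) z :=
  Encodable.encode_injective h

theorem code_and_towerAtom_eq (hA : IsVanishingMarkers T A) {g : X → ℕ → ℕ} {n : ℕ} {x y : X}
    (h : towerAtom T (A (n + 1)) (itineraryLabel T A g (n + 1)) x =
      towerAtom T (A (n + 1)) (itineraryLabel T A g (n + 1)) y) :
    g x n = g y n ∧ towerAtom T (A n) (itineraryLabel T A g n) x =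
      towerAtom T (A n) (itineraryLabel T A g n) y := by
  obtain ⟨hlabel, hheight⟩ := Prod.mk.injEq .. ▸ h
  have hc := apply_iterate_eq_of_itinerary_eq (itinerary_eq_of_itineraryLabel_eq hlabel)
    ((hA.isBirecurrent (n + 1)).height_lt_returnTime_lastVisit x)
  rwa [iterate_lastVisit, hheight, iterate_lastVisit, Prod.mk.injEq] at hc

/-- The tower system over `A` whose labels are the itineraries. -/
noncomputable def ofCode (hA : IsVanishingMarkers T A) (g : X → ℕ → ℕ) : TowerSystem T where
  base := A
  isVanishingMarkers := hA
  label := itineraryLabel T A g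
  label_zero _ := rfl
  returnTime_eq {n y z} _ _ h := by
    cases n with
    | zero =>
      have hone (w : X) : returnTime T (A 0) w = 1 :=
        le_antisymm (returnTime_le one_ne_zero (hA.zero ▸ mem_univ _)) (returnTime_pos T _ w)
      rw [hone, hone]
    | succ n => exact returnTime_eq_of_itinerary_eq (itinerary_eq_of_itineraryLabel_eq h)
  refines h := (code_and_towerAtom_eq hA h).2

theorem isComplete_ofCode [TopologicalSpace X] (hT : Continuous T) (hT' : Continuous T.symm)
    (hA : IsVanishingMarkers T A) (hclopen : ∀ n, IsClopen (A n)) {g : X → ℕ → ℕ}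
    (hg : IsClosedEmbedding g) : (ofCode hA g).IsComplete := by
  have hatom {n : ℕ} (h : IsLocallyConstant (itineraryLabel T A g n)) :
      IsLocallyConstant ((ofCode hA g).atom n) :=
    isLocallyConstant_towerAtom hT' (hA.isBirecurrent n) (hclopen n) h
  have hlabel (n : ℕ) : IsLocallyConstant (itineraryLabel T A g n) := by
    induction n with
    | zero => exact .const 0
    | succ n ih =>
      have hgn : IsLocallyConstant fun x => g x n :=
        (IsLocallyConstant.iff_continuous _).2 ((continuous_apply n).comp hg.continuous)
      exact (isLocallyConstant_itinerary hT (hA.isBirecurrent (n + 1)) (hclopen (n + 1))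
        (hgn.prodMk (hatom ih))).comp Encodable.encode
  have hcont : Continuous fun x n => (ofCode hA g).atom n x :=
    continuous_pi fun n => (hatom (hlabel n)).continuous
  have hfactor (n : ℕ) : (fun x => g x n).FactorsThrough ((ofCode hA g).atom (n + 1)) :=
    fun _ _ h => (code_and_towerAtom_eq hA h).1
  choose ψ hψ using fun n => (Function.factorsThrough_iff _).1 (hfactor n)
  have hcomp : (fun (a : ℕ → ℕ × ℕ) n => ψ n (a (n + 1))) ∘
      (fun x n => (ofCode hA g).atom n x) = g :=
    funext fun x => funext fun n => (congrFun (hψ n) x).symm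
  have hproper : IsProperMap fun x n => (ofCode hA g).atom n x :=
    isProperMap_of_comp_of_t2 hcont (by fun_prop) (hcomp ▸ hg.isProperMap)
  exact .of_continuous_injective_isClosedMap hcont
    (.of_comp (hcomp ▸ hg.injective)) hproper.isClosedMap

end TowerSystem

section PolishTopology

variable {X ι : Type*} [m : MeasurableSpace X] [Countable ι]

theorem borelSpace_of_le {t t' : TopologicalSpace X} (ht : @PolishSpace X t)
    (ht' : @PolishSpace X t') (hB : @BorelSpace X t m) (hle : t' ≤ t) : @BorelSpace X t' m :=
  @BorelSpace.mk X t' m (hB.measurable_eq.trans (borel_eq_borel_of_le ht' ht hle).symm)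

theorem exists_polishSpace_le_isClopen [t : TopologicalSpace X] [PolishSpace X] [BorelSpace X]
    {U : ι → Set X} (hU : ∀ i, MeasurableSet (U i)) :
    ∃ t' ≤ t, @PolishSpace X t' ∧ @BorelSpace X t' m ∧ ∀ i, @IsClopen X t' (U i) := by
  choose u hu hpolish hclosed hopen using fun i => (hU i).isClopenable
  obtain ⟨t', hle, hle', hpolish'⟩ := PolishSpace.exists_polishSpace_forall_le u hu hpolish
  exact ⟨t', hle', hpolish', borelSpace_of_le ‹_› hpolish' ‹_› hle',
    fun i => ⟨(hclosed i).mono (hle i), (hopen i).mono (hle i)⟩⟩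

theorem exists_polishSpace_le_continuous [t : TopologicalSpace X] [PolishSpace X] [BorelSpace X]
    {f : ι → X → X} (hf : ∀ i, Measurable (f i)) :
    ∃ t' ≤ t, @PolishSpace X t' ∧ @BorelSpace X t' m ∧ (∀ i, Continuous[t', t] (f i)) ∧
      ∀ x, ∀ s ∈ 𝓝 x, ∃ U ⊆ s, x ∈ U ∧ @IsClopen X t' U := by
  let 𝓑 := TopologicalSpace.countableBasis X
  have h𝓑 : TopologicalSpace.IsTopologicalBasis 𝓑 := TopologicalSpace.isBasis_countableBasis X
  have : Countable 𝓑 := (TopologicalSpace.countable_countableBasis X).to_subtype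
  have hopen (U : 𝓑) : MeasurableSet U.1 := (h𝓑.isOpen U.2).measurableSet
  have hmem (x : X) (s : Set X) (hs : s ∈ 𝓝 x) : ∃ U ∈ 𝓑, x ∈ U ∧ U ⊆ s := h𝓑.mem_nhds_iff.1 hs
  obtain ⟨t', hle, hpolish, hborel, hclopen⟩ := exists_polishSpace_le_isClopen
    (U := fun p : Option ι × 𝓑 => p.1.elim id f ⁻¹' p.2) fun p =>
      match p with
      | (none, U) => hopen U
      | (some i, U) => hf i (hopen U)
  refine ⟨t', hle, hpolish, hborel, fun i => ?_, fun x s hs => ?_⟩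
  · exact (@h𝓑.continuous_iff X X t' t 𝓑 _).2 fun U hU => (hclopen (some i, ⟨U, hU⟩)).isOpen
  · obtain ⟨U, hU, hxU, hUs⟩ := hmem x s hs
    exact ⟨U, hUs, hxU, hclopen (none, ⟨U, hU⟩)⟩

theorem exists_polishSpace_continuous_isClopen [StandardBorelSpace X] {f : ι → X → X}
    (hf : ∀ i, Measurable (f i)) {A : ℕ → Set X} (hA : ∀ n, MeasurableSet (A n)) :
    ∃ _ : TopologicalSpace X, PolishSpace X ∧ BorelSpace X ∧ (∀ i, Continuous (f i)) ∧
      (∀ n, IsClopen (A n)) ∧ TopologicalSpace.IsTopologicalBasis {U : Set X | IsClopen U} := by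
  let := upgradeStandardBorel X
  obtain ⟨t₀, -, hpolish₀, hborel₀, hA₀⟩ := exists_polishSpace_le_isClopen hA
  choose next hle hpolish hborel hcont hclopen using
    fun u : {t : TopologicalSpace X // @PolishSpace X t ∧ @BorelSpace X t m} =>
      @exists_polishSpace_le_continuous X ι m _ u.1 u.2.1 u.2.2 f hf
  let u (k : ℕ) : {t : TopologicalSpace X // @PolishSpace X t ∧ @BorelSpace X t m} :=
    (fun u => ⟨next u, hpolish u, hborel u⟩)^[k] ⟨t₀, hpolish₀, hborel₀⟩
  have hu (k : ℕ) : (u (k + 1)).1 = next (u k) := by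
    simp only [u, Function.iterate_succ_apply']
  have hanti : Antitone fun k => (u k).1 := antitone_nat_of_succ_le fun k => hu k ▸ hle (u k)
  let t : TopologicalSpace X := ⨅ k, (u k).1
  have ht (k : ℕ) : t ≤ (u k).1 := iInf_le _ k
  have hpolish_t : @PolishSpace X t :=
    .iInf ⟨0, fun k => hanti k.zero_le⟩ fun k => (u k).2.1
  refine ⟨t, hpolish_t, borelSpace_of_le hpolish₀ hpolish_t hborel₀ (ht 0), fun i => ?_,
    fun n => ⟨(hA₀ n).1.mono (ht 0), (hA₀ n).2.mono (ht 0)⟩, ?_⟩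
  · exact continuous_iInf_rng.2 fun k => continuous_le_dom ((ht (k + 1)).trans_eq (hu k))
      (hcont (u k) i)
  · refine TopologicalSpace.isTopologicalBasis_of_isOpen_of_nhds (fun U hU => hU.isOpen)
      fun x s hx hs => ?_
    have hs' : s ∈ ⨅ k, @nhds X (u k).1 x := nhds_iInf (t := fun k => (u k).1) ▸ hs.mem_nhds hx
    obtain ⟨k, hk⟩ := (mem_iInf_of_directed
      (directed_of_isDirected_le fun i j hij => nhds_mono (hanti hij)) _).1 hs'
    obtain ⟨U, hUs, hxU, hU⟩ := hclopen (u k) x s hk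
    have hle_next : t ≤ next (u k) := (ht (k + 1)).trans_eq (hu k)
    exact ⟨U, ⟨hU.1.mono hle_next, hU.2.mono hle_next⟩, hxU, hUs⟩

end PolishTopology

section BaireEmbedding

variable {X : Type*}

theorem exists_isLocallyConstant_dist_lt [PseudoMetricSpace X] [SecondCountableTopology X]
    (hX : TopologicalSpace.IsTopologicalBasis {U : Set X | IsClopen U}) {ε : ℝ} (hε : 0 < ε) :
    ∃ σ : X → ℕ, IsLocallyConstant σ ∧ ∀ x y, σ x = σ y → dist x y < ε := by
  rcases isEmpty_or_nonempty X with hempty | hnonempty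
  · exact ⟨fun _ => 0, .const 0, fun x => hempty.elim x⟩
  choose V hV hmem hball using fun x : X =>
    hX.mem_nhds_iff.1 (Metric.ball_mem_nhds x (half_pos hε))
  obtain ⟨s, hs, hcover⟩ := TopologicalSpace.countable_cover_nhds fun x => (hV x).isOpen.mem_nhds
    (hmem x)
  have hs' : s.Nonempty := by
    by_contra! h
    simp only [h, mem_empty_iff_false, iUnion_false, iUnion_empty, empty_ne_univ] at hcover
  obtain ⟨c, rfl⟩ := hs.exists_eq_range hs'
  have hexists (x : X) : ∃ k, x ∈ V (c k) := by
    simpa only [biUnion_range, mem_iUnion] using hcover.symm.subset (mem_univ x)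
  refine ⟨_, isLocallyConstant_sInf (fun k => hV (c k)) hexists, fun x y h => ?_⟩
  have hx : x ∈ V (c (sInf {k | x ∈ V (c k)})) := Nat.sInf_mem (hexists x)
  have hy : y ∈ V (c (sInf {k | y ∈ V (c k)})) := Nat.sInf_mem (hexists y)
  rw [← h] at hy
  exact (dist_triangle_right x y _).trans_lt
    ((add_lt_add (hball _ hx) (hball _ hy)).trans_eq (add_halves ε))

theorem exists_isClosedEmbedding_baire [TopologicalSpace X] [PolishSpace X]
    (hX : TopologicalSpace.IsTopologicalBasis {U : Set X | IsClopen U}) :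
    ∃ g : X → ℕ → ℕ, IsClosedEmbedding g := by
  let := TopologicalSpace.upgradeIsCompletelyMetrizable X
  choose σ hσ hdist using fun n : ℕ =>
    exists_isLocallyConstant_dist_lt hX (Nat.one_div_pos_of_nat (α := ℝ) (n := n))
  have hcont : Continuous fun x n => σ n x := continuous_pi fun n => (hσ n).continuous
  have hinj : Function.Injective fun x n => σ n x := fun x y h => by
    by_contra hne
    obtain ⟨n, hn⟩ := exists_nat_one_div_lt (dist_pos.2 hne)
    exact hn.not_gt (hdist n x y (congrFun h n))
  have hproper : IsProperMap fun x n => σ n x := by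
    refine isProperMap_iff_ultrafilter.2 ⟨hcont, fun 𝒰 a ha => ?_⟩
    have hcauchy : Cauchy (𝒰 : Filter X) := Metric.cauchy_iff.2 ⟨𝒰.neBot, fun ε hε => by
      obtain ⟨n, hn⟩ := exists_nat_one_div_lt hε
      have hn_mem : {x | σ n x = a n} ∈ (𝒰 : Filter X) :=
        (tendsto_pi_nhds.1 ha n).eventually_mem ((isOpen_discrete {a n}).mem_nhds rfl)
      exact ⟨_, hn_mem, fun x hx y hy => (hdist n x y (hx.trans hy.symm)).trans hn⟩⟩
    obtain ⟨x, hx⟩ := CompleteSpace.complete hcauchy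
    exact ⟨x, tendsto_nhds_unique ((hcont.tendsto x).mono_left hx) ha, hx⟩
  exact ⟨_, .of_continuous_injective_isClosedMap hcont hinj hproper.isClosedMap⟩

end BaireEmbedding

section Markers

theorem frequently_abs_sub_liminf_lt {u : ℕ → ℝ} {C : ℝ} (hu : ∀ k, |u k| ≤ C) {ε : ℝ}
    (hε : 0 < ε) : ∃ᶠ k in atTop, |u k - liminf u atTop| < ε := by
  have hbounded : IsBoundedUnder (· ≥ ·) atTop u :=
    isBoundedUnder_of ⟨-C, fun k => (abs_le.1 (hu k)).1⟩
  have hcobounded : IsCoboundedUnder (· ≥ ·) atTop u :=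
    IsBoundedUnder.isCoboundedUnder_ge (isBoundedUnder_of ⟨C, fun k => (abs_le.1 (hu k)).2⟩)
  have hupper : ∃ᶠ k in atTop, u k < liminf u atTop + ε :=
    frequently_lt_of_liminf_lt hcobounded (lt_add_of_pos_right _ hε)
  have hlower : ∀ᶠ k in atTop, liminf u atTop - ε < u k :=
    eventually_lt_of_lt_liminf (sub_lt_self _ hε) hbounded
  refine (hupper.and_eventually hlower).mono fun k hk => abs_sub_lt_iff.2 ⟨?_, ?_⟩ <;>
    linarith [hk.1, hk.2]

variable {X : Type*}

/-- The points at which `f` is `ε`-close, but not equal, to its lower limit along the forward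
orbit. -/
def nearLiminf (T : X → X) (f : X → ℝ) (ε : ℝ) : Set X :=
  {x | f x ≠ liminf (fun k => f (T^[k] x)) atTop ∧
    |f x - liminf (fun k => f (T^[k] x)) atTop| < ε}

theorem nearLiminf_mono (T : X → X) (f : X → ℝ) : Monotone (nearLiminf T f) :=
  fun _ _ hle _ hx => ⟨hx.1, hx.2.trans_le hle⟩

theorem exists_notMem_nearLiminf (T : X → X) (f : X → ℝ) (x : X) :
    ∃ n : ℕ, x ∉ nearLiminf T f (1 / (n + 1)) := by
  by_contra! h
  obtain ⟨n, hn⟩ := exists_nat_one_div_lt (abs_pos.2 (sub_ne_zero.2 (h 0).1))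
  exact hn.not_gt (h n).2

theorem measurableSet_nearLiminf [MeasurableSpace X] {T : X → X} (hT : Measurable T)
    {f : X → ℝ} (hf : Measurable f) (ε : ℝ) : MeasurableSet (nearLiminf T f ε) := by
  have hliminf : Measurable fun x => liminf (fun k => f (T^[k] x)) atTop :=
    .liminf fun k => hf.comp (hT.iterate k)
  exact (measurableSet_eq_fun hf hliminf).compl.inter
    (measurableSet_lt (hf.sub hliminf).abs measurable_const)

theorem exists_iterate_mem_nearLiminf {T : X → X} {f : X → ℝ} {x : X}
    (hinj : Function.Injective fun k => f (T^[k] x)) {C : ℝ} (hC : ∀ x, |f x| ≤ C) {ε : ℝ}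
    (hε : 0 < ε) : ∃ k, T^[k] x ∈ nearLiminf T f ε := by
  have hne : ∀ᶠ k in atTop, f (T^[k] x) ≠ liminf (fun k => f (T^[k] x)) atTop := by
    rw [← Nat.cofinite_eq_atTop]
    exact hinj.tendsto_cofinite.eventually (eventually_cofinite_ne _)
  obtain ⟨k, hlt, hk⟩ :=
    ((frequently_abs_sub_liminf_lt (fun k => hC (T^[k] x)) hε).and_eventually hne).exists
  have hinvariant :
      liminf (fun j => f (T^[j] (T^[k] x))) atTop = liminf (fun j => f (T^[j] x)) atTop := by
    simp only [← Function.iterate_add_apply]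
    exact liminf_nat_add (fun j => f (T^[j] x)) k
  refine ⟨k, ?_⟩
  rw [nearLiminf, mem_ofPred_eq, hinvariant]
  exact ⟨hk, hlt⟩

theorem injective_iterate_of_aperiodic {T : X → X} (hT : Function.Injective T) {x : X}
    (hx : ∀ n, 0 < n → T^[n] x ≠ x) : Function.Injective fun k => T^[k] x := by
  refine .of_lt_imp_ne fun j k hjk h => hx (k - j) (Nat.sub_pos_of_lt hjk) ?_
  refine (hT.iterate j ?_).symm
  simpa only [← Function.iterate_add_apply, Nat.add_sub_cancel' hjk.le] using h

theorem symm_iterate_ne_of_aperiodic {T : Perm X} (hT : ∀ (x : X) (n : ℕ), 0 < n → T^[n] x ≠ x)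
    (x : X) (n : ℕ) (hn : 0 < n) : T.symm^[n] x ≠ x := fun h =>
  hT x n hn <| by conv_lhs => rw [← h, (T.rightInverse_symm.iterate n).eq]

/-- The markers cut out by the lower limits of `f` along the forward and the backward orbits. -/
def liminfMarker (T : Perm X) (f : X → ℝ) : ℕ → Set X
  | 0 => univ
  | n + 1 => nearLiminf T f (1 / (n + 1)) ∪ nearLiminf T.symm f (1 / (n + 1))

theorem antitone_liminfMarker (T : Perm X) (f : X → ℝ) : Antitone (liminfMarker T f) := by
  refine antitone_nat_of_succ_le fun n => ?_
  cases n with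
  | zero => exact subset_univ _
  | succ n =>
    have hle : (1 : ℝ) / ((n + 1 : ℕ) + 1) ≤ 1 / (n + 1) := Nat.one_div_le_one_div n.le_succ
    exact union_subset_union (nearLiminf_mono T f hle) (nearLiminf_mono T.symm f hle)

theorem isBirecurrent_liminfMarker {T : Perm X} (hT : ∀ (x : X) (n : ℕ), 0 < n → T^[n] x ≠ x)
    {f : X → ℝ} (hf : Function.Injective f) {C : ℝ} (hC : ∀ x, |f x| ≤ C) (n : ℕ) :
    IsBirecurrent T (liminfMarker T f n) := by
  cases n with
  | zero => exact ⟨fun x => ⟨0, mem_univ _⟩, fun x => ⟨0, mem_univ _⟩⟩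
  | succ n =>
    refine ⟨fun x => ?_, fun x => ?_⟩
    · exact (exists_iterate_mem_nearLiminf (hf.comp (injective_iterate_of_aperiodic T.injective
        (hT x))) hC Nat.one_div_pos_of_nat).imp fun _ => Or.inl
    · exact (exists_iterate_mem_nearLiminf (hf.comp (injective_iterate_of_aperiodic
        T.symm.injective (symm_iterate_ne_of_aperiodic hT x))) hC Nat.one_div_pos_of_nat).imp
          fun _ => Or.inr

theorem iInter_liminfMarker (T : Perm X) (f : X → ℝ) : ⋂ n, liminfMarker T f n = ∅ := by
  refine eq_empty_of_forall_notMem fun x hx => ?_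
  have hmem (n : ℕ) := mem_iInter.1 hx (n + 1)
  obtain ⟨j, hj⟩ := exists_notMem_nearLiminf T f x
  obtain ⟨k, hk⟩ := exists_notMem_nearLiminf T.symm f x
  have hmono {i : ℕ} (hi : i ≤ max j k) := Nat.one_div_le_one_div (α := ℝ) hi
  exact (hmem (max j k)).elim (fun h => hj (nearLiminf_mono T f (hmono (le_max_left j k)) h))
    fun h => hk (nearLiminf_mono T.symm f (hmono (le_max_right j k)) h)

theorem exists_isVanishingMarkers [MeasurableSpace X] [StandardBorelSpace X] (T : X ≃ᵐ X)
    (hT : ∀ (x : X) (n : ℕ), 0 < n → T^[n] x ≠ x) :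
    ∃ A : ℕ → Set X, IsVanishingMarkers T.toEquiv A ∧ ∀ n, MeasurableSet (A n) := by
  obtain ⟨g, hg⟩ := exists_measurableEmbedding_real X
  let f : X → ℝ := fun x => Real.arctan (g x)
  have hmeas : Measurable f := Real.continuous_arctan.measurable.comp hg.measurable
  have hinj : Function.Injective f := Real.arctan_injective.comp hg.injective
  have hbounded (x : X) : |f x| ≤ Real.pi / 2 :=
    abs_le.2 ⟨(Real.neg_pi_div_two_lt_arctan _).le, (Real.arctan_lt_pi_div_two _).le⟩
  refine ⟨liminfMarker T.toEquiv f, ⟨rfl, antitone_liminfMarker _ f,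
    isBirecurrent_liminfMarker hT hinj hbounded, iInter_liminfMarker _ f⟩, fun n => ?_⟩
  cases n with
  | zero => exact .univ
  | succ n =>
    exact (measurableSet_nearLiminf T.measurable hmeas _).union
      (measurableSet_nearLiminf T.symm.measurable hmeas _)

end Markers

theorem theorem4p2 {X : Type*} [MeasurableSpace X] [StandardBorelSpace X] [Nonempty X]
    (T : X ≃ᵐ X) (hT : ∀ (x : X) (n : ℕ), 0 < n → T^[n] x ≠ x) :
    ∃ (B : OrderedBorelBratteliDiagram) (φ : B.Path ≃ᵐ B.Path),
      (∀ y, φ y = B.vershik y) ∧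
        ∃ F : X ≃ᵐ B.Path, ∀ x, F (T x) = φ (F x) := by
  obtain ⟨A, hA, hmeas⟩ := exists_isVanishingMarkers T hT
  obtain ⟨_, _, _, hcont, hclopen, hbasis⟩ := exists_polishSpace_continuous_isClopen
    (f := fun b : Bool => bif b then T else T.symm)
    (Bool.forall_bool.2 ⟨T.symm.measurable, T.measurable⟩) hmeas
  obtain ⟨g, hg⟩ := exists_isClosedEmbedding_baire hbasis
  exact TowerSystem.exists_vershik_conjugacy
    (TowerSystem.isComplete_ofCode (T := T.toEquiv) (hcont true) (hcont false) hA hclopen hg)
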